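/- Let $k$ be an algebraically closed field and let $G$ be a linear algebraic group over $k$, that is, a Zariski closed subgroup of some $GL_n(k)$. Let $V$ be a finite dimensional rational $G$-module and $W \le V$ a $G$-submodule such that $V/W \cong k$ as $G$-modules, where $k$ is the trivial module; fix such an isomorphism, and let $V \to k$ be the resulting surjection with kernel $W$. The group $G$ acts on the open subvariety $\mathbb{P}(V)-\mathbb{P}(W)$ of $\mathbb{P}(V)$ by $g\,[v]=[gv]$. Then $\mathbb{P}(V)-\mathbb{P}(W)$ is isomorphic as a variety to the affine space $\mathbb{A}^m$, $m=\dim_k W$, and for every subgroup $H \le G$ the following hold. 1. $\mathbb{P}(V)-\mathbb{P}(W)$ has an $H$-fixed point if and only if the extension $$0 \rightarrow W \rightarrow V \rightarrow k \rightarrow 0$$ splits over $H$, i.e. $V \to k$ has an $H$-equivariant $k$-linear section. 2. If $\mathbb{P}(V)-\mathbb{P}(W)$ has an $H$-fixed point, then the action of $H$ on it is linearizable: there are a finite dimensional rational $H$-module $E$ and an $H$-equivariant isomorphism of varieties $\mathbb{P}(V)-\mathbb{P}(W) \cong E$. (A finite dimensional $H$-module is rational if its matrix coefficients are restrictions to $H$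 of regular functions on $GL_n$.) -/

import Mathlib

open scoped LinearAlgebra.Projectivization MatrixGroups

/-! ### Linear algebraic groups and rational modules -/

/-- The ring of regular functions on the variety `GL_n` over `k`: the `k`-algebra of functions
generated by the matrix entries and by the inverse of the determinant. -/
def regularFunctionsGL (k : Type*) [Field k] (n : ℕ) : Subalgebra k (GL (Fin n) k → k) :=
  Algebra.adjoin k
    ((Set.range fun ij : Fin n × Fin n => fun g : GL (Fin n) k =>
        (g : Matrix (Fin n) (Fin n) k) ij.1 ij.2) ∪
      {fun g : GL (Fin n) k => (Matrix.det (g : Matrix (Fin n) (Fin n) k))⁻¹})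

/-- A subgroup of `GL_n(k)` is Zariski closed if it is the common zero locus of a set of regular
functions.  Over an algebraically closed field the linear algebraic groups are, up to isomorphism,
the Zariski closed subgroups of the groups `GL_n(k)`. -/
def IsZariskiClosedSubgroup {k : Type*} [Field k] {n : ℕ} (G : Subgroup (GL (Fin n) k)) : Prop :=
  ∃ S : Set (GL (Fin n) k → k), S ⊆ regularFunctionsGL k n ∧
    ∀ g : GL (Fin n) k, g ∈ G ↔ ∀ f ∈ S, f g = 0

/-- A (finite dimensional) representation of `G ≤ GL_n(k)` is rational if all of its matrix
coefficients are regular functions on `G`, i.e. restrictions of regular functions on `GL_n`. -/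
def IsRationalModule {k : Type*} [Field k] {n : ℕ} (G : Subgroup (GL (Fin n) k))
    {V : Type*} [AddCommGroup V] [Module k V] (ρ : Representation k G V) : Prop :=
  ∀ (v : V) (φ : Module.Dual k V), ∃ f ∈ regularFunctionsGL k n,
    ∀ g : G, φ (ρ g v) = f (g : GL (Fin n) k)

/-- Restriction of a representation of `G` to a subgroup `H ≤ G`. -/
abbrev restrictRep {k : Type*} [Field k] {Γ : Type*} [Group Γ] {G H : Subgroup Γ} (hH : H ≤ G)
    {V : Type*} [AddCommGroup V] [Module k V] (ρ : Representation k G V) : Representation k H V :=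
  ρ.comp (Subgroup.inclusion hH)

/-- The quotient module `V / W`. -/
abbrev quotientRep {k : Type*} [Field k] {Γ : Type*} [Group Γ]
    {V : Type*} [AddCommGroup V] [Module k V] {ρ : Representation k Γ V}
    (W : Subrepresentation ρ) : Representation k Γ (V ⧸ W.toSubmodule) :=
  ρ.quotient W.toSubmodule fun g _ hv => W.apply_mem_toSubmodule g hv

/-- Let `W ≤ V` be `G`-modules and let `e : V / W ≅ k` be an isomorphism of `G`-modules, where `k`
is the trivial module.  The extension `0 → W → V → k → 0`, in which `V → k` is `v ↦ e (v + W)`,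
splits over `H ≤ G` if `V → k` has an `H`-equivariant linear section. -/
def ExtensionSplitsOver {k : Type*} [Field k] {Γ : Type*} [Group Γ] {G H : Subgroup Γ} (hH : H ≤ G)
    {V : Type*} [AddCommGroup V] [Module k V] {ρ : Representation k G V}
    (W : Subrepresentation ρ)
    (e : (quotientRep W).Equiv (Representation.trivial k G k)) : Prop :=
  ∃ s : Representation.IntertwiningMap (Representation.trivial k H k) (restrictRep hH ρ),
    ∀ c : k, e (W.toSubmodule.mkQ (s c)) = c

/-! ### Classical varieties as spaces with functions -/

/-- A topology on `X` together with, for every (open) set `U`, the set of those functions that are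
regular on `U`.  A function is given on all of `X`, but only its values on `U` matter. -/
structure SpaceWithFunctions (k : Type*) (X : Type*) where
  topology : TopologicalSpace X
  regular : Set X → Set (X → k)

namespace SpaceWithFunctions

/-- The space with functions determined by a family of pairs `(D, f)`, each consisting of a basic
open set `D` and a function `f` on `D`: the sets `D` generate the topology, and a function is
regular on `U` if near each point of `U` it agrees with one of the functions `f`. -/
def ofFractions {k X : Type*} (B : Set (Set X × (X → k))) : SpaceWithFunctions k X where
  topology := TopologicalSpace.generateFrom (Prod.fst '' B)
  regular U := {F | ∀ x ∈ U, ∃ b ∈ B, x ∈ b.1 ∧ ∀ y ∈ b.1 ∩ U, F y = b.2 y}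

/-- Morphisms: continuous maps that pull back regular functions to regular functions. -/
def IsMorphism {k X Y : Type*} (𝒳 : SpaceWithFunctions k X) (𝒴 : SpaceWithFunctions k Y)
    (φ : X → Y) : Prop :=
  (@Continuous X Y 𝒳.topology 𝒴.topology φ) ∧
    ∀ U : Set Y, 𝒴.topology.IsOpen U → ∀ F ∈ 𝒴.regular U, F ∘ φ ∈ 𝒳.regular (φ ⁻¹' U)

/-- A bijection is an isomorphism if it is a morphism in both directions. -/
def IsIsomorphism {k X Y : Type*} (𝒳 : SpaceWithFunctions k X) (𝒴 : SpaceWithFunctions k Y)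
    (φ : X ≃ Y) : Prop :=
  IsMorphism 𝒳 𝒴 φ ∧ IsMorphism 𝒴 𝒳 φ.symm

end SpaceWithFunctions

/-- The polynomial functions on a vector space: the algebra of functions generated by the linear
forms. -/
def polyFunctions (k : Type*) [Field k] (E : Type*) [AddCommGroup E] [Module k E] :
    Subalgebra k (E → k) :=
  Algebra.adjoin k (Set.range fun φ : Module.Dual k E => (φ : E → k))

/-- Homogeneous polynomial functions of degree `d` (over an infinite field). -/
def IsHomogeneousPolynomialFunction {k : Type*} [Field k] {E : Type*} [AddCommGroup E] [Module k E]
    (d : ℕ) (p : E → k) : Prop :=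
  p ∈ polyFunctions k E ∧ ∀ (c : k) (v : E), p (c • v) = c ^ d * p v

/-- The variety structure on a finite dimensional vector space: basic open sets `q ≠ 0` and
fractions `p / q`, for polynomial functions `p` and `q`. -/
def affineSpaceVariety (k : Type*) [Field k] (E : Type*) [AddCommGroup E] [Module k E] :
    SpaceWithFunctions k E :=
  SpaceWithFunctions.ofFractions
    {b | ∃ p ∈ polyFunctions k E, ∃ q ∈ polyFunctions k E,
      b = ({x | q x ≠ 0}, fun x => p x / q x)}

/-! ### The variety `ℙ(V) - ℙ(W)` and its group action -/

/-- `ℙ(W)` as a subset of `ℙ(V)`. -/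
def projectiveSubspace {k : Type*} [Field k] {V : Type*} [AddCommGroup V] [Module k V]
    (W : Submodule k V) : Set (ℙ k V) :=
  Set.range (Projectivization.map W.subtype W.injective_subtype)

/-- The set of points of `ℙ(V) - ℙ(W)`. -/
abbrev ProjectiveComplement {k : Type*} [Field k] {V : Type*} [AddCommGroup V] [Module k V]
    (W : Submodule k V) : Type _ :=
  {x : ℙ k V // x ∉ projectiveSubspace W}

/-- The variety structure on `ℙ(V) - ℙ(W)` as an open subvariety of `ℙ(V)`: basic open sets
`q ≠ 0` and fractions `p / q`, for homogeneous polynomial functions `p` and `q` of the same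
degree.  (The values do not depend on the chosen representative of a point.) -/
def projectiveComplementVariety {k : Type*} [Field k] {V : Type*} [AddCommGroup V] [Module k V]
    (W : Submodule k V) : SpaceWithFunctions k (ProjectiveComplement W) :=
  SpaceWithFunctions.ofFractions
    {b | ∃ (d : ℕ) (p q : V → k), IsHomogeneousPolynomialFunction d p ∧
      IsHomogeneousPolynomialFunction d q ∧
      b = ({x | q x.1.rep ≠ 0}, fun x => p x.1.rep / q x.1.rep)}

theorem mem_projectiveSubspace_iff {k : Type*} [Field k] {V : Type*} [AddCommGroup V] [Module k V]
    (W : Submodule k V) (v : V) (hv : v ≠ 0) :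
    Projectivization.mk k v hv ∈ projectiveSubspace W ↔ v ∈ W := by
  constructor
  · rintro ⟨y, hy⟩
    induction y using Projectivization.ind with
    | h w hw =>
      rw [Projectivization.map_mk, Projectivization.mk_eq_mk_iff'] at hy
      obtain ⟨a, ha⟩ := hy
      have hne : a ≠ 0 := by
        rintro rfl
        rw [zero_smul] at ha
        exact hw (Subtype.ext ha.symm)
      have h2 : v = a⁻¹ • (w : V) := by
        have h3 : a • v = (w : V) := ha
        rw [← h3, smul_smul, inv_mul_cancel₀ hne, one_smul]
      rw [h2]
      exact W.smul_mem _ w.2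
  · intro h
    refine ⟨Projectivization.mk k ⟨v, h⟩ (fun h0 => hv (congrArg Subtype.val h0)), ?_⟩
    rw [Projectivization.map_mk]
    rfl

theorem map_notMem_projectiveSubspace {k : Type*} [Field k] {Γ : Type*} [Group Γ]
    {V : Type*} [AddCommGroup V] [Module k V] {ρ : Representation k Γ V}
    (W : Subrepresentation ρ) (g : Γ) (x : ℙ k V) (hx : x ∉ projectiveSubspace W.toSubmodule) :
    x.map (ρ g) (ρ.apply_bijective g).injective ∉ projectiveSubspace W.toSubmodule := by
  induction x using Projectivization.ind with
  | h v hv =>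
    rw [Projectivization.map_mk, mem_projectiveSubspace_iff]
    rw [mem_projectiveSubspace_iff] at hx
    intro h
    apply hx
    have h2 := W.apply_mem_toSubmodule g⁻¹ h
    simpa using h2

/-- The action of `G` on `ℙ(V) - ℙ(W)` induced by the linear action on `V`: `g [v] = [g v]`. -/
def projectiveComplementAction {k : Type*} [Field k] {Γ : Type*} [Group Γ]
    {V : Type*} [AddCommGroup V] [Module k V] {ρ : Representation k Γ V}
    (W : Subrepresentation ρ) : Γ →* Equiv.Perm (ProjectiveComplement W.toSubmodule) :=
  MonoidHom.toHomPerm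
    { toFun := fun g x => ⟨x.1.map (ρ g) (ρ.apply_bijective g).injective,
        map_notMem_projectiveSubspace W g x.1 x.2⟩
      map_one' := by
        funext x
        apply Subtype.ext
        obtain ⟨x, hx⟩ := x
        induction x using Projectivization.ind with
        | h v hv =>
          simp only [Projectivization.map_mk, map_one, Module.End.one_apply]
          rfl
      map_mul' := by
        intro g h
        funext x
        apply Subtype.ext
        obtain ⟨x, hx⟩ := x
        induction x using Projectivization.ind with
        | h v hv =>
          simp only [Projectivization.map_mk, map_mul, Module.End.mul_apply]
          rfl }

/-- A group action has a fixed point. -/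
def HasFixedPoint {Γ X : Type*} [Group Γ] (a : Γ →* Equiv.Perm X) : Prop :=
  ∃ x : X, ∀ g : Γ, a g x = x

/-- The action of `H ≤ GL_n(k)` on a variety is linearizable if the variety is `H`-equivariantly
isomorphic to a finite dimensional rational `H`-module. -/
def IsLinearizable {k : Type*} [Field k] {n : ℕ} {H : Subgroup (GL (Fin n) k)} {X : Type*}
    (𝒳 : SpaceWithFunctions k X) (a : H →* Equiv.Perm X) : Prop :=
  ∃ (m : ℕ) (σ : Representation k H (Fin m → k)) (φ : X ≃ (Fin m → k)),
    IsRationalModule H σ ∧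
    SpaceWithFunctions.IsIsomorphism 𝒳 (affineSpaceVariety k (Fin m → k)) φ ∧
    ∀ (h : H) (x : X), φ (a h x) = σ h (φ x)

/-! Let `ℓ : V → k` be the composite of the quotient map with `e`; it is `G`-invariant with kernel
`W`. Once `v₀` with `ℓ v₀ = 1` is chosen, each line outside `W` meets the hyperplane `ℓ = 1`, that
is `v₀ + W`, in exactly one point, and translating by `-v₀` gives the chart onto `W`. Homogenizing
with powers of `ℓ`, and restricting forms to `v₀ + W`, show that the chart and its inverse are
morphisms (`isIsomorphism_affineChart`). A line outside `W` stable under `H` is fixed pointwise,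
because `ℓ` is invariant. So fixed points and equivariant sections both amount to an `H`-fixed
vector on `ℓ = 1`. Taking that vector as the origin `v₀` makes the affine action on `v₀ + W` the
linear action on `W`. -/

namespace SpaceWithFunctions

/-- A map between spaces of fractions is a morphism as soon as it pulls back each of the basic
fractions to a basic fraction. -/
theorem isMorphism_ofFractions {k X Y : Type*} {B : Set (Set X × (X → k))}
    {C : Set (Set Y × (Y → k))} {φ : X → Y}
    (h : ∀ c ∈ C, ∃ b ∈ B, b.1 = φ ⁻¹' c.1 ∧ ∀ x ∈ b.1, b.2 x = c.2 (φ x)) :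
    IsMorphism (ofFractions B) (ofFractions C) φ := by
  constructor
  · refine continuous_generateFrom_iff.2 ?_
    rintro _ ⟨c, hc, rfl⟩
    obtain ⟨b, hb, hbc, -⟩ := h c hc
    rw [← hbc]
    exact TopologicalSpace.isOpen_generateFrom_of_mem ⟨b, hb, rfl⟩
  · intro U _ F hF x hx
    obtain ⟨c, hc, hxc, hFc⟩ := hF (φ x) hx
    obtain ⟨b, hb, hbc, hval⟩ := h c hc
    refine ⟨b, hb, by rw [hbc]; exact hxc, ?_⟩
    rintro y ⟨hy, hyU⟩
    rw [hval y hy]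
    exact hFc (φ y) ⟨by rw [hbc] at hy; exact hy, hyU⟩

end SpaceWithFunctions

/-! ### Polynomial functions, homogeneity and homogenization -/

section PolynomialFunctions

variable {k : Type*} [Field k] {V : Type*} [AddCommGroup V] [Module k V]
  {E : Type*} [AddCommGroup E] [Module k E]

theorem linearForm_mem_polyFunctions (φ : Module.Dual k V) : (φ : V → k) ∈ polyFunctions k V :=
  Algebra.subset_adjoin ⟨φ, rfl⟩

/-- Polynomial functions pull back to polynomial functions along affine maps. -/
theorem polyFunctions_comp_affine (v₀ : V) (f : E →ₗ[k] V) {p : V → k}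
    (hp : p ∈ polyFunctions k V) : (fun y => p (v₀ + f y)) ∈ polyFunctions k E := by
  induction hp using Algebra.adjoin_induction with
  | mem p hp =>
    obtain ⟨φ, rfl⟩ := hp
    simp only [map_add]
    exact add_mem ((polyFunctions k E).algebraMap_mem (φ v₀))
      (linearForm_mem_polyFunctions (φ ∘ₗ f))
  | algebraMap c => exact (polyFunctions k E).algebraMap_mem c
  | add p q _ _ hp hq => exact add_mem hp hq
  | mul p q _ _ hp hq => exact mul_mem hp hq

namespace IsHomogeneousPolynomialFunction

theorem mul {d d' : ℕ} {p q : V → k} (hp : IsHomogeneousPolynomialFunction d p)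
    (hq : IsHomogeneousPolynomialFunction d' q) :
    IsHomogeneousPolynomialFunction (d + d') (fun v => p v * q v) :=
  ⟨mul_mem hp.1 hq.1, fun c v => by simp only [hp.2, hq.2]; ring⟩

theorem add {d : ℕ} {p q : V → k} (hp : IsHomogeneousPolynomialFunction d p)
    (hq : IsHomogeneousPolynomialFunction d q) :
    IsHomogeneousPolynomialFunction d (fun v => p v + q v) :=
  ⟨add_mem hp.1 hq.1, fun c v => by simp only [hp.2, hq.2]; ring⟩

theorem linearForm (φ : Module.Dual k V) : IsHomogeneousPolynomialFunction 1 (φ : V → k) :=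
  ⟨linearForm_mem_polyFunctions φ, fun c v => by simp⟩

theorem linearForm_pow (φ : Module.Dual k V) (d : ℕ) :
    IsHomogeneousPolynomialFunction d (fun v => φ v ^ d) :=
  ⟨pow_mem (linearForm_mem_polyFunctions φ) d, fun c v => by simp [mul_pow]⟩

theorem const (c : k) : IsHomogeneousPolynomialFunction 0 (fun _ : V => c) :=
  ⟨(polyFunctions k V).algebraMap_mem c, fun _ _ => by simp⟩

/-- Homogenization of a polynomial function with respect to a linear form. -/
theorem exists_homogenization (ℓ : Module.Dual k V) (π : V →ₗ[k] E) {p : E → k}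
    (hp : p ∈ polyFunctions k E) :
    ∃ (d : ℕ) (P : V → k), IsHomogeneousPolynomialFunction d P ∧
      ∀ v, ℓ v ≠ 0 → P v = ℓ v ^ d * p ((ℓ v)⁻¹ • π v) := by
  induction hp using Algebra.adjoin_induction with
  | mem p hp =>
    obtain ⟨φ, rfl⟩ := hp
    exact ⟨1, φ ∘ₗ π, linearForm (φ ∘ₗ π), fun v hv => by simp [hv]⟩
  | algebraMap c => exact ⟨0, fun _ => c, const c, fun v hv => by simp⟩
  | add p q _ _ hp hq =>
    obtain ⟨d, P, hP, hPv⟩ := hp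
    obtain ⟨d', Q, hQ, hQv⟩ := hq
    -- The two degrees may differ, so each summand is padded by a power of `ℓ` to reach the common
    -- degree `d + d'`.
    refine ⟨d + d', fun v => P v * ℓ v ^ d' + ℓ v ^ d * Q v,
      (hP.mul (linearForm_pow ℓ d')).add ((linearForm_pow ℓ d).mul hQ), fun v hv => ?_⟩
    simp only [hPv v hv, hQv v hv, Pi.add_apply]
    ring
  | mul p q _ _ hp hq =>
    obtain ⟨d, P, hP, hPv⟩ := hp
    obtain ⟨d', Q, hQ, hQv⟩ := hq
    refine ⟨d + d', fun v => P v * Q v, hP.mul hQ, fun v hv => ?_⟩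
    simp only [hPv v hv, hQv v hv, Pi.mul_apply]
    ring

end IsHomogeneousPolynomialFunction

end PolynomialFunctions

/-! ### The affine chart on the complement of a hyperplane -/

section AffineChart

variable {k : Type*} [Field k] {V : Type*} [AddCommGroup V] [Module k V]
  {E : Type*} [AddCommGroup E] [Module k E] {W : Submodule k V}
  {ℓ : Module.Dual k V} {v₀ : V}

theorem notMem_projectiveSubspace_iff (hW : ∀ v, v ∈ W ↔ ℓ v = 0) (x : ℙ k V) :
    x ∉ projectiveSubspace W ↔ ℓ x.rep ≠ 0 := by
  conv_lhs => rw [← x.mk_rep]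
  rw [mem_projectiveSubspace_iff, hW]

/-- The projection of `V` onto the hyperplane `W = ker ℓ` along a vector `v₀` with `ℓ v₀ = 1`. -/
def projectionAlong (hW : ∀ v, v ∈ W ↔ ℓ v = 0) (hv₀ : ℓ v₀ = 1) : V →ₗ[k] W :=
  (LinearMap.id - ℓ.smulRight v₀).codRestrict W fun v => by simp [hW, hv₀]

theorem coe_projectionAlong (hW : ∀ v, v ∈ W ↔ ℓ v = 0) (hv₀ : ℓ v₀ = 1) (v : V) :
    (projectionAlong hW hv₀ v : V) = v - ℓ v • v₀ := rfl

theorem add_ne_zero_of_apply_eq_one (hW : ∀ v, v ∈ W ↔ ℓ v = 0) (hv₀ : ℓ v₀ = 1) (w : W) :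
    v₀ + (w : V) ≠ 0 := by
  intro h
  have := congrArg ℓ h
  simp [hv₀, (hW w).1 w.2] at this

/-- The affine chart `[v] ↦ v / ℓ v - v₀` of the complement of the hyperplane `W = ker ℓ`, read in
a vector space `E` isomorphic to `W`. -/
noncomputable def affineChart (hW : ∀ v, v ∈ W ↔ ℓ v = 0) (hv₀ : ℓ v₀ = 1) (b : W ≃ₗ[k] E) :
    ProjectiveComplement W ≃ E where
  toFun x := (ℓ x.1.rep)⁻¹ • b (projectionAlong hW hv₀ x.1.rep)
  invFun y := ⟨Projectivization.mk k (v₀ + (b.symm y : V))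
      (add_ne_zero_of_apply_eq_one hW hv₀ (b.symm y)), by
    rw [mem_projectiveSubspace_iff, hW, map_add, (hW _).1 (b.symm y).2, hv₀]
    simp⟩
  left_inv x := by
    have hx := (notMem_projectiveSubspace_iff hW x.1).1 x.2
    apply Subtype.ext
    conv_rhs => rw [← x.1.mk_rep]
    rw [Projectivization.mk_eq_mk_iff']
    refine ⟨(ℓ x.1.rep)⁻¹, ?_⟩
    simp only [map_smul, LinearEquiv.symm_apply_apply, Submodule.coe_smul, coe_projectionAlong,
      smul_sub, smul_smul, inv_mul_cancel₀ hx, one_smul]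
    abel
  right_inv y := by
    -- The chosen representative is known only up to a unit `a`, which cancels because the chart
    -- formula has degree zero.
    obtain ⟨a, ha⟩ := Projectivization.exists_smul_eq_mk_rep k (v₀ + (b.symm y : V))
      (add_ne_zero_of_apply_eq_one hW hv₀ (b.symm y))
    have h1 : ℓ (v₀ + (b.symm y : V)) = 1 := by
      rw [map_add, (hW _).1 (b.symm y).2, hv₀, add_zero]
    have h2 : projectionAlong hW hv₀ (v₀ + (b.symm y : V)) = b.symm y := by
      apply Subtype.ext
      rw [coe_projectionAlong, h1]
      simp
    simp only [← ha, Units.smul_def, map_smul, h1, h2, LinearEquiv.apply_symm_apply, smul_eq_mul,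
      mul_one, smul_smul, inv_mul_cancel₀ a.ne_zero, one_smul]

theorem affineChart_apply (hW : ∀ v, v ∈ W ↔ ℓ v = 0) (hv₀ : ℓ v₀ = 1) (b : W ≃ₗ[k] E)
    (x : ProjectiveComplement W) :
    affineChart hW hv₀ b x = (ℓ x.1.rep)⁻¹ • b (projectionAlong hW hv₀ x.1.rep) := rfl

/-- The formula is invariant under scaling `v`, so any representative may replace `rep`; this is
what makes equivariance computable. -/
theorem affineChart_mk (hW : ∀ v, v ∈ W ↔ ℓ v = 0) (hv₀ : ℓ v₀ = 1) (b : W ≃ₗ[k] E)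
    (v : V) (hv : v ≠ 0) (hx : Projectivization.mk k v hv ∉ projectiveSubspace W) :
    affineChart hW hv₀ b ⟨Projectivization.mk k v hv, hx⟩ =
      (ℓ v)⁻¹ • b (projectionAlong hW hv₀ v) := by
  obtain ⟨a, ha⟩ := Projectivization.exists_smul_eq_mk_rep k v hv
  rw [affineChart_apply]
  simp only [← ha, Units.smul_def, map_smul, smul_eq_mul, smul_smul, mul_inv_rev]
  rw [inv_mul_cancel_right₀ a.ne_zero]

theorem exists_rep_affineChart_symm (hW : ∀ v, v ∈ W ↔ ℓ v = 0) (hv₀ : ℓ v₀ = 1)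
    (b : W ≃ₗ[k] E) (y : E) :
    ∃ a : k, a ≠ 0 ∧ ((affineChart hW hv₀ b).symm y).1.rep = a • (v₀ + (b.symm y : V)) := by
  obtain ⟨a, ha⟩ := Projectivization.exists_smul_eq_mk_rep k (v₀ + (b.symm y : V))
    (add_ne_zero_of_apply_eq_one hW hv₀ (b.symm y))
  exact ⟨a, a.ne_zero, ha.symm⟩

theorem isIsomorphism_affineChart (hW : ∀ v, v ∈ W ↔ ℓ v = 0) (hv₀ : ℓ v₀ = 1) (b : W ≃ₗ[k] E) :
    SpaceWithFunctions.IsIsomorphism (projectiveComplementVariety W) (affineSpaceVariety k E)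
      (affineChart hW hv₀ b) := by
  constructor
  · apply SpaceWithFunctions.isMorphism_ofFractions
    rintro _ ⟨p, hp, q, hq, rfl⟩
    obtain ⟨d, P, hP, hPv⟩ := IsHomogeneousPolynomialFunction.exists_homogenization ℓ
      (b.toLinearMap ∘ₗ projectionAlong hW hv₀) hp
    obtain ⟨d', Q, hQ, hQv⟩ := IsHomogeneousPolynomialFunction.exists_homogenization ℓ
      (b.toLinearMap ∘ₗ projectionAlong hW hv₀) hq
    have hP' (x : ProjectiveComplement W) :
        P x.1.rep = ℓ x.1.rep ^ d * p (affineChart hW hv₀ b x) :=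
      hPv _ ((notMem_projectiveSubspace_iff hW x.1).1 x.2)
    have hQ' (x : ProjectiveComplement W) :
        Q x.1.rep = ℓ x.1.rep ^ d' * q (affineChart hW hv₀ b x) :=
      hQv _ ((notMem_projectiveSubspace_iff hW x.1).1 x.2)
    -- `P` and `Q` may have different degrees. The crossed powers of `ℓ` equalize them and offset
    -- the factors `ℓ ^ d` and `ℓ ^ d'` from homogenization; `ℓ` has no zero on the complement.
    refine ⟨_, ⟨d + d', fun v => P v * ℓ v ^ d', fun v => ℓ v ^ d * Q v,
      hP.mul (.linearForm_pow ℓ d'), (IsHomogeneousPolynomialFunction.linearForm_pow ℓ d).mul hQ,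
      rfl⟩, ?_, ?_⟩
    · ext x
      have hx := (notMem_projectiveSubspace_iff hW x.1).1 x.2
      simp [hQ', hx]
    · intro x _
      have hx := (notMem_projectiveSubspace_iff hW x.1).1 x.2
      simp only [hP', hQ']
      have h : ℓ x.1.rep ^ d * ℓ x.1.rep ^ d' ≠ 0 :=
        mul_ne_zero (pow_ne_zero _ hx) (pow_ne_zero _ hx)
      rw [← mul_div_mul_left (p _) (q _) h]
      ring
  · apply SpaceWithFunctions.isMorphism_ofFractions
    rintro _ ⟨d, p, q, hp, hq, rfl⟩
    -- Dehomogenization: restrict both forms to `v₀ + W`. Passing to `rep` multiplies each by the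
    -- same `a ^ d`, which leaves the quotient and the nonvanishing set unchanged.
    refine ⟨_, ⟨fun y => p (v₀ + (b.symm y : V)),
      polyFunctions_comp_affine v₀ (W.subtype ∘ₗ b.symm.toLinearMap) hp.1,
      fun y => q (v₀ + (b.symm y : V)),
      polyFunctions_comp_affine v₀ (W.subtype ∘ₗ b.symm.toLinearMap) hq.1, rfl⟩, ?_, ?_⟩
    · ext y
      obtain ⟨a, ha, hay⟩ := exists_rep_affineChart_symm hW hv₀ b y
      simp only [Set.mem_ofPred_eq, Set.mem_preimage, hay, hq.2]
      simp [ha]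
    · intro y _
      obtain ⟨a, ha, hay⟩ := exists_rep_affineChart_symm hW hv₀ b y
      simp only [hay, hp.2, hq.2]
      rw [mul_div_mul_left _ _ (pow_ne_zero d ha)]

end AffineChart

/-! ### Fixed points, fixed vectors and splittings -/

section Extension

variable {k : Type*} [Field k] {V : Type*} [AddCommGroup V] [Module k V]

/-- The linear form `V → V / W ≅ k`. -/
def extensionForm {Γ : Type*} [Group Γ] {ρ : Representation k Γ V} {W : Subrepresentation ρ}
    (e : (quotientRep W).Equiv (Representation.trivial k Γ k)) : Module.Dual k V :=
  e.toLinearEquiv.toLinearMap ∘ₗ W.toSubmodule.mkQ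

theorem mem_iff_extensionForm_eq_zero {Γ : Type*} [Group Γ] {ρ : Representation k Γ V}
    {W : Subrepresentation ρ} (e : (quotientRep W).Equiv (Representation.trivial k Γ k)) (v : V) :
    v ∈ W.toSubmodule ↔ extensionForm e v = 0 := by
  have : extensionForm e v = e.toLinearEquiv (W.toSubmodule.mkQ v) := rfl
  rw [this, LinearEquiv.map_eq_zero_iff, Submodule.mkQ_apply, Submodule.Quotient.mk_eq_zero]

theorem extensionForm_apply_rho {Γ : Type*} [Group Γ] {ρ : Representation k Γ V}
    {W : Subrepresentation ρ} (e : (quotientRep W).Equiv (Representation.trivial k Γ k))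
    (g : Γ) (v : V) : extensionForm e (ρ g v) = extensionForm e v :=
  e.toIntertwiningMap.isIntertwining _ _ g (W.toSubmodule.mkQ v)

theorem exists_extensionForm_eq_one {Γ : Type*} [Group Γ] {ρ : Representation k Γ V}
    {W : Subrepresentation ρ} (e : (quotientRep W).Equiv (Representation.trivial k Γ k)) :
    ∃ v, extensionForm e v = 1 := by
  obtain ⟨v, hv⟩ := W.toSubmodule.mkQ_surjective (e.toLinearEquiv.symm 1)
  exact ⟨v, (congrArg e.toLinearEquiv hv).trans (e.toLinearEquiv.apply_symm_apply 1)⟩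

variable {Γ : Type*} [Group Γ] {G H : Subgroup Γ} (hH : H ≤ G) {ρ : Representation k G V}
  {W : Subrepresentation ρ} (e : (quotientRep W).Equiv (Representation.trivial k G k))

/-- A fixed point in `ℙ(V) - ℙ(W)` is represented by a fixed vector lying over `1`. -/
theorem hasFixedPoint_iff_exists_fixed_vector :
    HasFixedPoint ((projectiveComplementAction W).comp (Subgroup.inclusion hH)) ↔
      ∃ v, extensionForm e v = 1 ∧ ∀ h : H, ρ (Subgroup.inclusion hH h) v = v := by
  constructor
  · rintro ⟨⟨x, hx⟩, hfix⟩
    induction x using Projectivization.ind with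
    | h v hv =>
      have hℓ : extensionForm e v ≠ 0 := by
        rwa [mem_projectiveSubspace_iff, mem_iff_extensionForm_eq_zero e] at hx
      refine ⟨(extensionForm e v)⁻¹ • v, by simp [hℓ], fun h => ?_⟩
      have h1 : (Projectivization.mk k v hv).map (ρ (Subgroup.inclusion hH h))
          (ρ.apply_bijective _).injective = Projectivization.mk k v hv :=
        congrArg Subtype.val (hfix h)
      rw [Projectivization.map_mk, Projectivization.mk_eq_mk_iff'] at h1
      obtain ⟨a, ha⟩ := h1
      -- A stable line gives only an eigenvector; invariance of `ℓ` together with `ℓ v ≠ 0` forces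
      -- the eigenvalue to be `1`.
      have h2 : a = 1 := by
        have h3 := congrArg (extensionForm e) ha
        rw [extensionForm_apply_rho, map_smul, smul_eq_mul] at h3
        exact mul_right_cancel₀ hℓ (h3.trans (one_mul _).symm)
      rw [map_smul, ← ha, h2, one_smul]
  · rintro ⟨v, hv1, hfix⟩
    have hv : v ≠ 0 := by
      rintro rfl
      simp at hv1
    refine ⟨⟨Projectivization.mk k v hv, ?_⟩, fun h => Subtype.ext ?_⟩
    · rw [mem_projectiveSubspace_iff, mem_iff_extensionForm_eq_zero e, hv1]
      exact one_ne_zero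
    · change (Projectivization.mk k v hv).map (ρ (Subgroup.inclusion hH h))
        (ρ.apply_bijective _).injective = _
      rw [Projectivization.map_mk, Projectivization.mk_eq_mk_iff']
      exact ⟨1, by rw [one_smul, hfix]⟩

/-- A linear section is determined by its value at `1`, and it is equivariant exactly when that
value is fixed. -/
theorem extensionSplitsOver_iff_exists_fixed_vector :
    ExtensionSplitsOver hH W e ↔
      ∃ v, extensionForm e v = 1 ∧ ∀ h : H, ρ (Subgroup.inclusion hH h) v = v := by
  constructor
  · rintro ⟨s, hs⟩
    exact ⟨s 1, hs 1, fun h => (s.isIntertwining _ _ h 1).symm⟩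
  · rintro ⟨v, hv1, hfix⟩
    refine ⟨(LinearMap.toSpanSingleton k V v).intertwiningMap_of_isIntertwiningMap _ _ ?_, ?_⟩
    · intro h c
      change c • v = ρ (Subgroup.inclusion hH h) (c • v)
      rw [map_smul, hfix]
    · intro c
      change extensionForm e (c • v) = c
      rw [map_smul, hv1, smul_eq_mul, mul_one]

end Extension

/-! ### Permanence properties of rational modules -/

section RationalModules

variable {k : Type*} [Field k] {n : ℕ} {G H : Subgroup (GL (Fin n) k)}
  {V : Type*} [AddCommGroup V] [Module k V] {ρ : Representation k G V}

namespace IsRationalModule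

theorem restrictRep (hρ : IsRationalModule G ρ) (hH : H ≤ G) :
    IsRationalModule H (restrictRep hH ρ) := fun v φ => by
  obtain ⟨f, hf, hfg⟩ := hρ v φ
  exact ⟨f, hf, fun h => hfg (Subgroup.inclusion hH h)⟩

theorem toRepresentation (hρ : IsRationalModule G ρ) (W : Subrepresentation ρ) :
    IsRationalModule G W.toRepresentation := fun w φ => by
  -- Extending the functional from `W` to `V` turns a matrix coefficient of `W` into one of `V`.
  obtain ⟨ψ, hψ⟩ := LinearMap.exists_extend φ
  obtain ⟨f, hf, hfg⟩ := hρ w ψ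
  exact ⟨f, hf, fun g => by rw [← hψ, ← hfg]; rfl⟩

/-- Rationality is invariant under isomorphisms of modules. -/
theorem of_linearEquiv {E : Type*} [AddCommGroup E] [Module k E] {σ : Representation k G E}
    (hρ : IsRationalModule G ρ) (b : V ≃ₗ[k] E) (hb : ∀ g v, b (ρ g v) = σ g (b v)) :
    IsRationalModule G σ := fun y φ => by
  obtain ⟨f, hf, hfg⟩ := hρ (b.symm y) (φ ∘ₗ b.toLinearMap)
  exact ⟨f, hf, fun g => by rw [← hfg]; simp [hb]⟩

end IsRationalModule

end RationalModules

/-! ### Linearizing the action at a fixed point -/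

section Linearization

variable {k : Type*} [Field k] {n : ℕ} {G H : Subgroup (GL (Fin n) k)}
  {V : Type*} [AddCommGroup V] [Module k V] [Module.Finite k V] {ρ : Representation k G V}
  {W : Subrepresentation ρ} (e : (quotientRep W).Equiv (Representation.trivial k G k))

theorem isLinearizable_of_fixed_vector (hρ : IsRationalModule G ρ) (hH : H ≤ G) {v₀ : V}
    (hv₀ : extensionForm e v₀ = 1) (hfix : ∀ h : H, ρ (Subgroup.inclusion hH h) v₀ = v₀) :
    IsLinearizable (projectiveComplementVariety W.toSubmodule)
      ((projectiveComplementAction W).comp (Subgroup.inclusion hH)) := by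
  have hW := mem_iff_extensionForm_eq_zero e
  let b := (Module.finBasis k W.toSubmodule).equivFun
  let τ : Representation k H W.toSubmodule := restrictRep hH W.toRepresentation
  let σ : Representation k H (Fin (Module.finrank k W.toSubmodule) → k) :=
    (b.conjAlgEquiv k : _ →* _).comp τ
  have hσ (h : H) (w : W.toSubmodule) : b (τ h w) = σ h (b w) := by
    change _ = b (τ h (b.symm (b w)))
    rw [b.symm_apply_apply]
  refine ⟨_, σ, affineChart hW hv₀ b,
    ((hρ.toRepresentation W).restrictRep hH).of_linearEquiv b hσ,
    isIsomorphism_affineChart hW hv₀ b, ?_⟩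
  rintro h ⟨x, hx⟩
  induction x using Projectivization.ind with
  | h v hv =>
    have hne : ρ (Subgroup.inclusion hH h) v ≠ 0 := fun h0 =>
      hv ((ρ.apply_bijective _).injective (h0.trans (map_zero _).symm))
    -- The projection `v ↦ v - ℓ v • v₀` commutes with `H` because `ℓ` is invariant and `v₀` is
    -- fixed; this is where the fixed vector is needed.
    have hproj : projectionAlong hW hv₀ (ρ (Subgroup.inclusion hH h) v) =
        τ h (projectionAlong hW hv₀ v) := by
      apply Subtype.ext
      change _ = ρ (Subgroup.inclusion hH h) (projectionAlong hW hv₀ v : V)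
      rw [coe_projectionAlong, coe_projectionAlong, extensionForm_apply_rho, map_sub, map_smul,
        hfix]
    have hmem : Projectivization.mk k (ρ (Subgroup.inclusion hH h) v) hne ∉
        projectiveSubspace W.toSubmodule :=
      map_notMem_projectiveSubspace W (Subgroup.inclusion hH h) _ hx
    calc affineChart hW hv₀ b (projectiveComplementAction W (Subgroup.inclusion hH h)
          ⟨Projectivization.mk k v hv, hx⟩)
        = affineChart hW hv₀ b
            ⟨Projectivization.mk k (ρ (Subgroup.inclusion hH h) v) hne, hmem⟩ := rfl
      _ = σ h (affineChart hW hv₀ b ⟨Projectivization.mk k v hv, hx⟩) := by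
        rw [affineChart_mk, affineChart_mk, hproj, extensionForm_apply_rho, hσ, map_smul]

end Linearization

theorem mainTheorem12 {k : Type*} [Field k] [IsAlgClosed k] {n : ℕ}
    (G : Subgroup (GL (Fin n) k)) (hG : IsZariskiClosedSubgroup G)
    {V : Type*} [AddCommGroup V] [Module k V] [Module.Finite k V]
    (ρ : Representation k G V) (hρ : IsRationalModule G ρ)
    (W : Subrepresentation ρ)
    (e : (quotientRep W).Equiv (Representation.trivial k G k))
    (H : Subgroup (GL (Fin n) k)) (hH : H ≤ G) :
    (∃ φ : ProjectiveComplement W.toSubmodule ≃ (Fin (Module.finrank k W.toSubmodule) → k),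
      SpaceWithFunctions.IsIsomorphism (projectiveComplementVariety W.toSubmodule)
        (affineSpaceVariety k (Fin (Module.finrank k W.toSubmodule) → k)) φ) ∧
    (HasFixedPoint ((projectiveComplementAction W).comp (Subgroup.inclusion hH)) ↔
      ExtensionSplitsOver hH W e) ∧
    (HasFixedPoint ((projectiveComplementAction W).comp (Subgroup.inclusion hH)) →
      IsLinearizable (projectiveComplementVariety W.toSubmodule)
        ((projectiveComplementAction W).comp (Subgroup.inclusion hH))) := by
  have hW := mem_iff_extensionForm_eq_zero e
  refine ⟨?_, ?_, fun h => ?_⟩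
  · obtain ⟨v₀, hv₀⟩ := exists_extensionForm_eq_one e
    exact ⟨affineChart hW hv₀ (Module.finBasis k W.toSubmodule).equivFun,
      isIsomorphism_affineChart hW hv₀ _⟩
  · rw [hasFixedPoint_iff_exists_fixed_vector hH e,
      extensionSplitsOver_iff_exists_fixed_vector hH e]
  · obtain ⟨v₀, hv₀, hfix⟩ := (hasFixedPoint_iff_exists_fixed_vector hH e).1 h
    exact isLinearizable_of_fixed_vector e hρ hH hv₀ hfix
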